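/- There is an orientation-reversing homeomorphism $h:\mathbb R^2\to\mathbb R^2$ without fixed points such that: (1) the set of periodic points of $h$ (the points $x$ with $h^n(x)=x$ for some integer $n\ge 1$) is exactly $\big((-\infty,-1]\cup[1,\infty)\big)\times\{0\}$, and every periodic point has least period $2$; (2) for every non-periodic point $x\in\mathbb R^2$, the orbit $\{h^n(x):n\in\mathbb Z\}$ is bounded and $\omega(x,h)=\alpha(x,h)=\{(-1,0),(1,0)\}$. Here $\omega(x,h)$ is the set of all limits of sequences $h^{n_i}(x)$ with positive integers $n_1<n_2<\cdots$, and $\alpha(x,h)=\omega(x,h^{-1})$. In particular, every orbit of $h$ is bounded although $h$ has no fixed point, so $h$ is a counterexample to the bounded orbit conjecture, which asserts that every homeomorphism of $\mathbb R^2$ all of whose orbits are bounded has a fixed point. Orientation-reversing means that for every $p\in\mathbb R^2$ and every $r>0$, the image under $h$ of the counterclockwise circle with centre $p$ and radius $r$ has winding number $-1$ around $h(p)$. -/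

import Mathlib

open Filter Topology

namespace PlaneHomeo

/-- The full orbit `{fⁿ(x) : n ∈ ℤ}` of `x` under a homeomorphism `f`. -/
def orbit {X : Type*} [TopologicalSpace X] (f : X ≃ₜ X) (x : X) : Set X :=
  Set.range fun n : ℤ => (f ^ n) x

/-- The `ω`-limit set of `x` under `f`: all limits of `f^{n_i}(x)` along sequences of
positive integers `n_0 < n_1 < n_2 < ⋯`. -/
def omegaLimitSet {X : Type*} [TopologicalSpace X] (f : X ≃ₜ X) (x : X) : Set X :=
  {y | ∃ n : ℕ → ℕ, StrictMono n ∧ (∀ i, 0 < n i) ∧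
    Tendsto (fun i => (⇑f)^[n i] x) atTop (𝓝 y)}

/-- The `α`-limit set of `x` under `f` is the `ω`-limit set of `x` under the inverse of `f`. -/
def alphaLimitSet {X : Type*} [TopologicalSpace X] (f : X ≃ₜ X) (x : X) : Set X :=
  omegaLimitSet f.symm x

/-- The counterclockwise parametrization, `t ∈ [0, 2π]`, of the Euclidean circle with centre `p`
and radius `r`. -/
noncomputable def circlePath (p : ℝ × ℝ) (r t : ℝ) : ℝ × ℝ :=
  p + r • (Real.cos t, Real.sin t)

/-- The closed curve `γ`, parametrized by `t ∈ [0, 2π]`, avoids `q` and has winding number `n`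
around `q`: there is a continuous choice `θ` of the polar angle of `γ` about `q`, and the total
change of `θ` is `2πn`. -/
def HasWindingNumber (γ : ℝ → ℝ × ℝ) (q : ℝ × ℝ) (n : ℤ) : Prop :=
  ∃ θ : ℝ → ℝ, ContinuousOn θ (Set.Icc 0 (2 * Real.pi)) ∧
    (∀ t ∈ Set.Icc 0 (2 * Real.pi), ∃ ρ : ℝ, 0 < ρ ∧
      γ t = q + ρ • (Real.cos (θ t), Real.sin (θ t))) ∧
    θ (2 * Real.pi) - θ 0 = 2 * Real.pi * n

/-- A homeomorphism `h` of the plane is orientation reversing if its local degree is `-1`: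
for every counterclockwise circle, with centre `p`, the image curve has winding number `-1`
around `h p`. -/
def IsOrientationReversing (h : (ℝ × ℝ) ≃ₜ (ℝ × ℝ)) : Prop :=
  ∀ (p : ℝ × ℝ) (r : ℝ), 0 < r → HasWindingNumber (fun t => h (circlePath p r t)) (h p) (-1)

end PlaneHomeo

/-!
The complement `U` of the two rays is parametrized by coordinates `(ℓ, t) ∈ ℝ²` (`chart`), and the
homeomorphism is `(ℓ, t) ↦ (-ℓ + drift t, t + 1)` on `U` and `(x, 0) ↦ (-x, 0)` on the rays. Since
`t` increases, there is neither a fixed point nor a periodic point in `U`.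

The coordinates come from elliptic coordinates `(u, w) ↦ (sin u √(1 + w²), cos u · w)` on the strip
`|u| ≤ π / 2`, which fold each side of the strip onto one ray (`fold`), by putting `ℓ = tan u` and
`t = w (1 + ℓ²)`. A point of `U` approaches `(x₀, 0)` on a ray only if `ℓ → ±∞` while `w` stays
bounded. There, a change of `t` by `1` and a bounded change of `ℓ` change the point by arbitrarily
little. As `drift` is bounded, the map on `U` therefore extends continuously to the rays, by
`x ↦ -x`. The extension is written down on the closed strip (`stripGlide`) and descends to the plane
since `fold` is a proper surjection, hence a quotient map (`planeGlide`).

On the other hand, `(ℓ, t)` tends to `(1, 0)` or `(-1, 0)` as soon as `|ℓ|` grows linearly and `t`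
at most linearly, because then `w = t / (1 + ℓ²) → 0` (`tendsto_chart_sub`). The `n`-th iterate has
`(-1)ⁿ ℓₙ = ℓ₀ - ∑_{k < n} (-1)ᵏ drift (t + k)`, so it suffices that for every `t` the sequence
`(-1)ᵏ drift (t + k)` is eventually constant with value `±1`, in both directions of time. The sign
cannot be a continuous function of `t`, as it is reversed under `t ↦ t + 1`, but `drift` can be
continuous: the rank from which the sequence is constant is not locally bounded near
`t ∈ 1/2 + ℤ` (`drift`, `eventually_clamp_eq`).

The orientation is found by the homotopy `(ℓ, t) ↦ (-ℓ + τ drift t, t + τ)`, `0 ≤ τ ≤ 1`, through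
homeomorphisms of the plane, which starts at the reflection `(x, y) ↦ (-x, y)`; winding numbers
are invariant because a nonvanishing function on the `(τ, θ)`-plane has a continuous logarithm.
-/

namespace PlaneHomeo

/-! ### The folded strip -/

/-- The closed strip `[-1, 1] × ℝ`, with `[-1, 1]` realized as the closed upper unit half-circle:
the point `(a, k, w)` has horizontal coordinate `a`, vertical coordinate `w`, and
`k = √(1 - a²)`. -/
def strip : Set (ℝ × ℝ × ℝ) := {x | x.1 ^ 2 + x.2.1 ^ 2 = 1 ∧ 0 ≤ x.2.1}

/-- Elliptic coordinates, `(a, k, w) ↦ (a √(1 + w²), k w)`: with `a = sin u` and `w = sinh v` this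
is the map `u + iv ↦ sin (u + iv)`. The interior of the strip is mapped bijectively to the
complement of the rays `(-∞, -1] × {0}` and `[1, ∞) × {0}`, and each side of the strip is folded
at `w = 0` onto one ray. -/
noncomputable def fold (x : strip) : ℝ × ℝ :=
  (x.1.1 * √(1 + x.1.2.2 ^ 2), x.1.2.1 * x.1.2.2)

lemma fold_continuous : Continuous fold := by
  unfold fold; fun_prop

lemma fold_norm_sq (x : strip) :
    (fold x).1 ^ 2 + (fold x).2 ^ 2 = x.1.1 ^ 2 + x.1.2.2 ^ 2 := by
  obtain ⟨⟨a, k, w⟩, h1, h2⟩ := x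
  simp only [fold] at *
  rw [mul_pow, Real.sq_sqrt (by positivity)]
  linear_combination w ^ 2 * h1

lemma fold_isProperMap : IsProperMap fold := by
  rw [isProperMap_iff_isCompact_preimage]
  refine ⟨fold_continuous, fun K hK => ?_⟩
  obtain ⟨R, hR⟩ := hK.isBounded.subset_closedBall (0 : ℝ × ℝ)
  have hclosed : IsClosed strip :=
    (isClosed_eq (f := fun x : ℝ × ℝ × ℝ => x.1 ^ 2 + x.2.1 ^ 2) (by fun_prop)
      continuous_const).inter
      (isClosed_le (g := fun x : ℝ × ℝ × ℝ => x.2.1) continuous_const (by fun_prop))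
  rw [hclosed.isClosedEmbedding_subtypeVal.isInducing.isCompact_iff]
  refine Metric.isCompact_of_isClosed_isBounded
    (hclosed.isClosedEmbedding_subtypeVal.isClosedMap _ (hK.isClosed.preimage fold_continuous)) ?_
  refine (Metric.isBounded_closedBall (x := (0 : ℝ × ℝ × ℝ)) (r := 1 + 2 * |R|)).subset ?_
  rintro _ ⟨x, hx, rfl⟩
  have hn := fold_norm_sq x
  have hb := hR hx
  obtain ⟨⟨a, k, w⟩, h1, h2⟩ := x
  simp only [mem_closedBall_zero_iff, Prod.norm_def, Real.norm_eq_abs, sup_le_iff] at hb hn h1 h2 ⊢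
  have hR0 : R ≤ |R| := le_abs_self R
  have e1 : (fold ⟨(a, k, w), h1, h2⟩).1 ^ 2 ≤ |R| ^ 2 := sq_le_sq.2 (by
    rw [abs_abs]; exact hb.1.trans hR0)
  have e2 : (fold ⟨(a, k, w), h1, h2⟩).2 ^ 2 ≤ |R| ^ 2 := sq_le_sq.2 (by
    rw [abs_abs]; exact hb.2.trans hR0)
  have h0 := abs_nonneg R
  refine ⟨?_, ?_, ?_⟩ <;> refine abs_le_of_sq_le_sq ?_ (by positivity) <;> nlinarith [sq_nonneg a]

lemma fold_surjective : Function.Surjective fold := by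
  rintro ⟨x, y⟩
  -- `W = w²` is the nonnegative root of `W² + (1 - x² - y²) W - y² = 0`.
  set B : ℝ := x ^ 2 + y ^ 2 - 1 with hB
  set W : ℝ := (B + √(B ^ 2 + 4 * y ^ 2)) / 2 with hWdef
  have hs : √(B ^ 2 + 4 * y ^ 2) ^ 2 = B ^ 2 + 4 * y ^ 2 := Real.sq_sqrt (by positivity)
  have hs0 := Real.sqrt_nonneg (B ^ 2 + 4 * y ^ 2)
  have hW0 : 0 ≤ W := by
    have : -B ≤ √(B ^ 2 + 4 * y ^ 2) := Real.le_sqrt_of_sq_le (by nlinarith [sq_nonneg y])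
    simp only [hWdef]; linarith
  have hWeq : W ^ 2 = B * W + y ^ 2 := by
    simp only [hWdef]; linear_combination hs / 4
  have hfac : W * (1 + W - x ^ 2) = y ^ 2 * (1 + W) := by
    rw [hB] at hWeq; linear_combination hWeq
  have hxW : x ^ 2 ≤ 1 + W := by
    rcases hW0.eq_or_lt with h | h
    · rw [← h] at hfac
      have hy : y ^ 2 = 0 := by linarith
      have hb : √(B ^ 2 + 4 * y ^ 2) = |B| := by rw [hy]; simp [Real.sqrt_sq_eq_abs]
      rw [hb] at hWdef
      have : B ≤ 0 := by rw [abs_eq_neg_self.symm]; linarith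
      linarith
    · by_contra hcon
      push Not at hcon
      nlinarith [mul_pos h (sub_pos.2 hcon), mul_nonneg (sq_nonneg y) (by linarith : 0 ≤ 1 + W)]
  have h1W : 0 < 1 + W := by linarith
  have hsq : √(1 + W) ^ 2 = 1 + W := Real.sq_sqrt h1W.le
  have hsq0 : √(1 + W) ≠ 0 := (Real.sqrt_pos.2 h1W).ne'
  have hk0 : 0 ≤ 1 - x ^ 2 / (1 + W) := by
    rw [sub_nonneg, div_le_one h1W]; exact hxW
  -- `|y| = k √W`
  have hkW : √(1 - x ^ 2 / (1 + W)) * √W = |y| := by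
    rw [← Real.sqrt_mul hk0, ← Real.sqrt_sq_eq_abs]
    congr 1
    field_simp
    linear_combination hfac
  have hmem : ∀ w : ℝ, (x / √(1 + W), √(1 - x ^ 2 / (1 + W)), w) ∈ strip := fun w =>
    ⟨by simp only [div_pow, hsq, Real.sq_sqrt hk0]; ring, Real.sqrt_nonneg _⟩
  have key : ∀ w : ℝ, w ^ 2 = W → √(1 - x ^ 2 / (1 + W)) * w = y →
      ∃ a, fold a = (x, y) := by
    intro w hw hy
    refine ⟨⟨_, hmem w⟩, ?_⟩
    simp only [fold, hw, hy, div_mul_cancel₀ _ hsq0]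
  rcases le_total 0 y with h | h
  · exact key √W (Real.sq_sqrt hW0) (by rw [hkW, abs_of_nonneg h])
  · exact key (-√W) (by rw [neg_sq, Real.sq_sqrt hW0])
      (by rw [mul_neg, hkW, abs_of_nonpos h, neg_neg])

lemma fold_eq_fold {x y : strip} (h : fold x = fold y) :
    x.1.1 = y.1.1 ∧ x.1.2.1 = y.1.2.1 ∧
      (x.1.2.2 = y.1.2.2 ∨ x.1.2.1 = 0 ∧ x.1.2.2 = -y.1.2.2) := by
  have hx := fold_norm_sq x
  have hy := fold_norm_sq y
  rw [h, hy] at hx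
  obtain ⟨⟨a, k, w⟩, h1, h2⟩ := x
  obtain ⟨⟨a', k', w'⟩, h1', h2'⟩ := y
  simp only [fold, Prod.mk.injEq] at h hx h1 h2 h1' h2' ⊢
  obtain ⟨e1, e2⟩ := h
  have e1s : a ^ 2 * (1 + w ^ 2) = a' ^ 2 * (1 + w' ^ 2) := by
    have := congrArg (· ^ 2) e1
    simpa only [mul_pow, Real.sq_sqrt (show (0 : ℝ) ≤ 1 + w ^ 2 by positivity),
      Real.sq_sqrt (show (0 : ℝ) ≤ 1 + w' ^ 2 by positivity)] using this
  have hA : a ^ 2 = a' ^ 2 := by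
    have hf : (a ^ 2 - a' ^ 2) * (k' ^ 2 + w ^ 2) = 0 := by
      linear_combination e1s + a' ^ 2 * hx + (a ^ 2 - a' ^ 2) * h1'
    rcases mul_eq_zero.1 hf with h0 | h0
    · linarith
    · have hk' : k' ^ 2 = 0 := by nlinarith [sq_nonneg k', sq_nonneg w]
      have hw : w ^ 2 = 0 := by nlinarith [sq_nonneg k', sq_nonneg w]
      nlinarith [sq_nonneg w', sq_nonneg k]
  have hww : w ^ 2 = w' ^ 2 := by linarith
  rw [hww] at e1
  have ha : a = a' := mul_right_cancel₀ (Real.sqrt_pos.2 (by positivity)).ne' e1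
  have hk : k = k' := by
    have : k ^ 2 = k' ^ 2 := by linarith
    exact (pow_left_inj₀ h2 h2' two_ne_zero).1 this
  refine ⟨ha, hk, ?_⟩
  rw [← hk] at e2
  rcases mul_eq_mul_left_iff.1 e2 with h0 | h0
  · exact Or.inl h0
  · rcases sq_eq_sq_iff_eq_or_eq_neg.1 hww with h3 | h3
    · exact Or.inl h3
    · exact Or.inr ⟨h0, h3⟩

/-! ### Glide reflections of the strip -/

/-- The coordinates `(ℓ, t)` on the interior of the strip: `a = ℓ / √(1 + ℓ²)` and
`w = t / (1 + ℓ²)`. -/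
noncomputable def interiorPt (p : ℝ × ℝ) : strip :=
  ⟨(p.1 / √(1 + p.1 ^ 2), 1 / √(1 + p.1 ^ 2), p.2 / (1 + p.1 ^ 2)), by
    constructor
    · have : (1 : ℝ) + p.1 ^ 2 ≠ 0 := by positivity
      simp only [div_pow, Real.sq_sqrt (show (0 : ℝ) ≤ 1 + p.1 ^ 2 by positivity)]
      field_simp
      ring
    · positivity⟩

lemma interiorPt_pos (p : ℝ × ℝ) : 0 < (interiorPt p).1.2.1 := by
  simp only [interiorPt]; positivity

lemma exists_interiorPt {x : strip} (hx : x.1.2.1 ≠ 0) : ∃ p, interiorPt p = x := by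
  obtain ⟨⟨a, k, w⟩, h1, h2⟩ := x
  simp only at hx h1 h2
  have hk : 0 < k := lt_of_le_of_ne h2 (Ne.symm hx)
  have e : 1 + (a / k) ^ 2 = (1 / k) ^ 2 := by field_simp; linarith
  refine ⟨(a / k, w / k ^ 2), Subtype.ext ?_⟩
  simp only [interiorPt, e, Real.sqrt_sq (show 0 ≤ 1 / k by positivity), Prod.mk.injEq]
  refine ⟨?_, ?_, ?_⟩ <;> field_simp

/-- The map `(ℓ, t) ↦ (-ℓ + c t, t + s)`. -/
def glide (c : ℝ → ℝ) (s : ℝ) (p : ℝ × ℝ) : ℝ × ℝ := (-p.1 + c p.2, p.2 + s)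

/-- `c t / √(1 + ℓ²)` in the coordinates of the strip. At the sides of the strip, where `k = 0`,
its value is `0`. -/
noncomputable def offset (c : ℝ → ℝ) (x : ℝ × ℝ × ℝ) : ℝ := x.2.1 * c (x.2.2 / x.2.1 ^ 2)

/-- The ratio `(1 + ℓ'²) / (1 + ℓ²)`, where `ℓ' = -ℓ + c t`, in the coordinates of the strip. -/
noncomputable def dilation (c : ℝ → ℝ) (x : ℝ × ℝ × ℝ) : ℝ :=
  (x.1 - offset c x) ^ 2 + x.2.1 ^ 2

lemma dilation_pos (c : ℝ → ℝ) {x : ℝ × ℝ × ℝ} (hx : x ∈ strip) : 0 < dilation c x := by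
  obtain ⟨a, k, w⟩ := x
  obtain ⟨h1, h2⟩ := hx
  simp only [dilation, offset] at *
  rcases h2.eq_or_lt with h | h
  · subst h
    simp only [zero_mul, sub_zero]
    linarith
  · positivity

/-- The extension of `glide c s` to the closed strip. -/
noncomputable def stripGlide (c : ℝ → ℝ) (s : ℝ) (x : strip) : strip :=
  ⟨(-(x.1.1 - offset c x.1) / √(dilation c x.1), x.1.2.1 / √(dilation c x.1),
      (x.1.2.2 + s * x.1.2.1 ^ 2) / dilation c x.1), by
    have hD := dilation_pos c x.2
    refine ⟨?_, div_nonneg x.2.2 (Real.sqrt_nonneg _)⟩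
    simp only [div_pow, Real.sq_sqrt hD.le, neg_sq]
    rw [← add_div, div_eq_one_iff_eq hD.ne', dilation]⟩

lemma stripGlide_interiorPt (c : ℝ → ℝ) (s : ℝ) (p : ℝ × ℝ) :
    stripGlide c s (interiorPt p) = interiorPt (glide c s p) := by
  obtain ⟨l, t⟩ := p
  have h0 : (0 : ℝ) < 1 + l ^ 2 := by positivity
  have hq : √(1 + l ^ 2) ^ 2 = 1 + l ^ 2 := Real.sq_sqrt h0.le
  have hq0 : 0 < √(1 + l ^ 2) := Real.sqrt_pos.2 h0
  have hoff : offset c (interiorPt (l, t)).1 = c t / √(1 + l ^ 2) := by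
    simp only [offset, interiorPt, div_pow, hq, one_pow]
    have : t / (1 + l ^ 2) / (1 / (1 + l ^ 2)) = t := by field_simp
    rw [this]; ring
  have h1 : (0 : ℝ) < 1 + (-l + c t) ^ 2 := by positivity
  have hdil : dilation c (interiorPt (l, t)).1 = (1 + (-l + c t) ^ 2) / (1 + l ^ 2) := by
    rw [dilation, hoff]
    simp only [interiorPt, ← sub_div, div_pow, hq]
    ring
  have hq1 : 0 < √(1 + (-l + c t) ^ 2) := Real.sqrt_pos.2 h1
  refine Subtype.ext ?_
  simp only [stripGlide, hdil, hoff, Real.sqrt_div h1.le]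
  simp only [interiorPt, glide, Prod.mk.injEq]
  refine ⟨?_, ?_, ?_⟩
  · field_simp
    ring
  · field_simp
  · rw [div_pow, hq]
    field_simp

lemma stripGlide_side (c : ℝ → ℝ) (s : ℝ) {x : strip} (hx : x.1.2.1 = 0) :
    (stripGlide c s x).1 = (-x.1.1, 0, x.1.2.2) := by
  obtain ⟨⟨a, k, w⟩, h1, h2⟩ := x
  simp only at hx h1
  subst hx
  have hD : dilation c (a, 0, w) = 1 := by
    simp only [dilation, offset, zero_mul, sub_zero]; linarith
  simp [stripGlide, hD, offset]

lemma fold_stripGlide_congr (c : ℝ → ℝ) (s : ℝ) {x y : strip} (h : fold x = fold y) :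
    fold (stripGlide c s x) = fold (stripGlide c s y) := by
  obtain ⟨h1, h2, h3 | ⟨h3, h4⟩⟩ := fold_eq_fold h
  · rw [Subtype.ext (Prod.ext h1 (Prod.ext h2 h3) : x.1 = y.1)]
  · simp only [fold, stripGlide_side c s h3, stripGlide_side c s (h2.symm.trans h3), h1, h4, neg_sq,
      zero_mul]

lemma stripGlide_continuous {c : ℝ → ℝ → ℝ} (hc : Continuous (Function.uncurry c))
    (hb : ∀ r t, |c r t| ≤ |r|) {s : ℝ → ℝ} (hs : Continuous s) :
    Continuous fun q : ℝ × strip => stripGlide (c q.1) (s q.1) q.2 := by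
  have hoff : Continuous fun q : ℝ × strip => offset (c q.1) q.2.1 := by
    rw [continuous_iff_continuousAt]
    rintro ⟨r, x⟩
    by_cases hk : x.1.2.1 = 0
    · have h0 : offset (c r) x.1 = 0 := by simp [offset, hk]
      rw [ContinuousAt, h0]
      refine squeeze_zero_norm (a := fun q : ℝ × strip => |q.2.1.2.1| * |q.1|) (fun q => ?_) ?_
      · rw [offset, Real.norm_eq_abs, abs_mul]
        exact mul_le_mul_of_nonneg_left (hb _ _) (abs_nonneg _)
      · have : Continuous fun q : ℝ × strip => |q.2.1.2.1| * |q.1| := by fun_prop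
        have h := this.tendsto (r, x)
        simpa only [hk, abs_zero, zero_mul] using h
    · have h1 : ContinuousAt (fun q : ℝ × strip => (q.1, q.2.1.2.2 / q.2.1.2.1 ^ 2)) (r, x) := by
        refine ContinuousAt.prodMk (by fun_prop) (ContinuousAt.div (by fun_prop) (by fun_prop) ?_)
        exact pow_ne_zero 2 hk
      have h2 := ContinuousAt.comp (f := fun q : ℝ × strip => (q.1, q.2.1.2.2 / q.2.1.2.1 ^ 2))
        (g := Function.uncurry c) hc.continuousAt h1
      exact ContinuousAt.mul (f := fun q : ℝ × strip => q.2.1.2.1) (by fun_prop) h2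
  have hdil : Continuous fun q : ℝ × strip => dilation (c q.1) q.2.1 := by
    unfold dilation; fun_prop
  have hpos : ∀ q : ℝ × strip, dilation (c q.1) q.2.1 ≠ 0 := fun q => (dilation_pos _ q.2.2).ne'
  have hsq : ∀ q : ℝ × strip, √(dilation (c q.1) q.2.1) ≠ 0 := fun q =>
    (Real.sqrt_pos.2 (dilation_pos _ q.2.2)).ne'
  refine Continuous.subtype_mk ?_ _
  fun_prop (disch := assumption)

/-! ### The induced maps of the plane -/

/-- The map of the plane induced by `glide c s`. It does not depend on the choice of the preimage
under `fold`, see `planeGlide_fold`. -/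
noncomputable def planeGlide (c : ℝ → ℝ) (s : ℝ) (z : ℝ × ℝ) : ℝ × ℝ :=
  fold (stripGlide c s (Function.surjInv fold_surjective z))

lemma planeGlide_fold (c : ℝ → ℝ) (s : ℝ) (x : strip) :
    planeGlide c s (fold x) = fold (stripGlide c s x) :=
  fold_stripGlide_congr c s (Function.surjInv_eq fold_surjective _)

lemma planeGlide_continuous {c : ℝ → ℝ → ℝ} (hc : Continuous (Function.uncurry c))
    (hb : ∀ r t, |c r t| ≤ |r|) {s : ℝ → ℝ} (hs : Continuous s) :
    Continuous fun q : ℝ × (ℝ × ℝ) => planeGlide (c q.1) (s q.1) q.2 := by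
  -- the product of a proper map with an identity map is again proper, hence a quotient map
  have hq : IsQuotientMap (Prod.map (id : ℝ → ℝ) fold) :=
    (isProperMap_id.prodMap fold_isProperMap).isClosedMap.isQuotientMap
      (continuous_id.prodMap fold_continuous) (Function.surjective_id.prodMap fold_surjective)
  rw [hq.continuous_iff]
  have : (fun q : ℝ × (ℝ × ℝ) => planeGlide (c q.1) (s q.1) q.2) ∘ Prod.map (id : ℝ → ℝ) fold =
      fun q : ℝ × strip => fold (stripGlide (c q.1) (s q.1) q.2) := by
    ext1 q
    exact planeGlide_fold _ _ _
  rw [this]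
  exact fold_continuous.comp (stripGlide_continuous hc hb hs)

/-- The parametrization of the complement of the two rays by the coordinates `(ℓ, t)`. -/
noncomputable def chart (p : ℝ × ℝ) : ℝ × ℝ := fold (interiorPt p)

lemma planeGlide_chart (c : ℝ → ℝ) (s : ℝ) (p : ℝ × ℝ) :
    planeGlide c s (chart p) = chart (glide c s p) := by
  rw [chart, planeGlide_fold, stripGlide_interiorPt, chart]

lemma planeGlide_ray (c : ℝ → ℝ) (s : ℝ) {z : ℝ × ℝ} (h1 : z.1 ≤ -1 ∨ 1 ≤ z.1) (h2 : z.2 = 0) :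
    planeGlide c s z = (-z.1, 0) := by
  obtain ⟨x, y⟩ := z
  simp only at h1 h2
  subst h2
  obtain ⟨a, ha, hx⟩ : ∃ a : ℝ, a ^ 2 = 1 ∧ x = a * |x| := by
    rcases h1 with h | h
    · exact ⟨-1, by norm_num, by rw [abs_of_neg (by linarith)]; ring⟩
    · exact ⟨1, by norm_num, by rw [abs_of_pos (by linarith)]; ring⟩
  have hx1 : 0 ≤ x ^ 2 - 1 := by rcases h1 with h | h <;> nlinarith
  have hmem : (a, (0 : ℝ), √(x ^ 2 - 1)) ∈ strip := ⟨by simp [ha], le_rfl⟩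
  have hw : √(1 + √(x ^ 2 - 1) ^ 2) = |x| := by
    rw [Real.sq_sqrt hx1, ← Real.sqrt_sq_eq_abs]; congr 1; ring
  have hf : fold ⟨_, hmem⟩ = (x, 0) := by
    simp only [fold, hw, zero_mul, ← hx]
  rw [← hf, planeGlide_fold]
  simp only [fold, stripGlide_side c s (x := ⟨_, hmem⟩) rfl, hw, zero_mul, neg_mul]

lemma chart_notMem_rays (p : ℝ × ℝ) :
    ¬(((chart p).1 ≤ -1 ∨ 1 ≤ (chart p).1) ∧ (chart p).2 = 0) := by
  rintro ⟨h1, h2⟩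
  have hk := interiorPt_pos p
  rw [chart] at h1 h2
  generalize interiorPt p = x at h1 h2 hk
  obtain ⟨⟨a, k, w⟩, h3, h4⟩ := x
  simp only [fold] at h1 h2 h3 hk
  have hw : w = 0 := (mul_eq_zero.1 h2).resolve_left hk.ne'
  subst hw
  simp only [ne_eq, OfNat.ofNat_ne_zero, not_false_eq_true, zero_pow, add_zero, Real.sqrt_one,
    mul_one] at h1
  rcases h1 with h | h <;> nlinarith

lemma chart_injective : Function.Injective chart := by
  intro p q h
  obtain ⟨h1, h2, h3⟩ := fold_eq_fold h
  replace h3 := h3.resolve_right fun h4 => (interiorPt_pos p).ne' h4.1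
  have key : ∀ p : ℝ × ℝ, p.1 = (interiorPt p).1.1 / (interiorPt p).1.2.1 ∧
      p.2 = (interiorPt p).1.2.2 / (interiorPt p).1.2.1 ^ 2 := by
    intro p
    have h0 : (0 : ℝ) < 1 + p.1 ^ 2 := by positivity
    have hq0 : 0 < √(1 + p.1 ^ 2) := Real.sqrt_pos.2 h0
    simp only [interiorPt, div_pow, Real.sq_sqrt h0.le]
    constructor <;> field_simp
  refine Prod.ext ?_ ?_
  · rw [(key p).1, (key q).1, h1, h2]
  · rw [(key p).2, (key q).2, h2, h3]

lemma ray_or_chart (z : ℝ × ℝ) :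
    ((z.1 ≤ -1 ∨ 1 ≤ z.1) ∧ z.2 = 0) ∨ ∃ p, chart p = z := by
  obtain ⟨x, rfl⟩ := fold_surjective z
  by_cases hk : x.1.2.1 = 0
  · left
    obtain ⟨⟨a, k, w⟩, h1, h2⟩ := x
    simp only at hk h1
    subst hk
    have hw : 1 ≤ √(1 + w ^ 2) := by
      rw [Real.one_le_sqrt]; nlinarith [sq_nonneg w]
    refine ⟨?_, by simp [fold]⟩
    have ha : (a - 1) * (a + 1) = 0 := by linarith
    rcases mul_eq_zero.1 ha with h | h
    · right
      have : a = 1 := by linarith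
      simpa [fold, this] using hw
    · left
      have : a = -1 := by linarith
      simpa [fold, this] using hw
  · right
    obtain ⟨p, hp⟩ := exists_interiorPt hk
    exact ⟨p, by rw [chart, hp]⟩

/-- The inverse of `(ℓ, t) ↦ (-ℓ + c t, t + s)` is `(ℓ, t) ↦ (-ℓ + c (t - s), t - s)`, a map of the
same kind. -/
lemma planeGlide_inverse {c c' : ℝ → ℝ} {s s' : ℝ} (hs : s + s' = 0) (hc : ∀ t, c' (t + s) = c t)
    (z : ℝ × ℝ) : planeGlide c' s' (planeGlide c s z) = z := by
  rcases ray_or_chart z with ⟨h1, h2⟩ | ⟨p, rfl⟩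
  · rw [planeGlide_ray c s h1 h2, planeGlide_ray]
    · simp [← h2]
    · rcases h1 with h | h
      · right; simp only; linarith
      · left; simp only; linarith
    · rfl
  · rw [planeGlide_chart, planeGlide_chart]
    congr 1
    simp only [glide, hc]
    exact Prod.ext (by simp) (by simp [add_assoc, hs])

lemma planeGlide_zero (z : ℝ × ℝ) : planeGlide (fun _ => 0) 0 z = (-z.1, z.2) := by
  obtain ⟨x, rfl⟩ := fold_surjective z
  have hD : dilation (fun _ => 0) x.1 = 1 := by
    simp only [dilation, offset, mul_zero, sub_zero]
    exact x.2.1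
  rw [planeGlide_fold]
  simp [fold, stripGlide, hD, offset]

/-! ### Orientation -/

/-- A continuous function with values in `2πiℤ` is constant. -/
lemma eq_of_exp_eq_one {g : ℝ → ℂ} (hg : Continuous g) (h : ∀ x, Complex.exp (g x) = 1)
    (x y : ℝ) : g x = g y := by
  have := Complex.isCoveringMap_exp.eq_of_comp_eq (g₁ := g) (g₂ := fun _ => g y) hg
    continuous_const (by ext z; simp [h]) y rfl
  exact congrFun this x

/-- Homotopy invariance of the winding number: a closed curve of nonzero vectors which can be
deformed through such curves to a clockwise circle has winding number `-1`. -/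
lemma hasWindingNumber_of_homotopy {F : ℝ × ℝ → ℝ × ℝ} (hF : Continuous F) (hF0 : ∀ x, F x ≠ 0)
    (hper : ∀ τ, F (τ, 2 * Real.pi) = F (τ, 0)) {r : ℝ} (hr : 0 < r)
    (hinit : ∀ t, F (0, t) = (-(r * Real.cos t), r * Real.sin t)) (q : ℝ × ℝ) :
    HasWindingNumber (fun t => q + F (1, t)) q (-1) := by
  have huniv : IsSimplyConnected (Set.univ : Set (ℝ × ℝ)) := by
    have := convex_univ (𝕜 := ℝ) (E := ℝ × ℝ) |>.contractibleSpace Set.univ_nonempty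
    exact SimplyConnectedSpace.ofContractible _
  set G : ℝ × ℝ → ℂ := fun x => ⟨(F x).1, (F x).2⟩ with hG
  have hGc : Continuous G := by
    have : G = fun x => Complex.equivRealProdCLM.symm (F x) := rfl
    rw [this]; fun_prop
  obtain ⟨L, hL, hexp⟩ := Complex.exists_continuousOn_eqOn_exp_comp huniv isOpen_univ
    (g := G) hGc.continuousOn (by
      rintro ⟨x, -, hx⟩
      exact hF0 x (Prod.ext (congrArg Complex.re hx) (congrArg Complex.im hx)))
  rw [continuousOn_univ] at hL
  replace hexp : ∀ x, Complex.exp (L x) = G x := fun x => hexp (Set.mem_univ x)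
  -- the total change of the logarithm along the curve does not depend on the curve
  have h1 : L (1, 2 * Real.pi) - L (1, 0) = L (0, 2 * Real.pi) - L (0, 0) :=
    eq_of_exp_eq_one (g := fun τ => L (τ, 2 * Real.pi) - L (τ, 0)) (by fun_prop) (fun τ => by
      rw [Complex.exp_sub, hexp, hexp, hG]
      simp only [hper]
      refine div_self fun h => hF0 (τ, 0) ?_
      exact Prod.ext (congrArg Complex.re h) (congrArg Complex.im h)) 1 0
  -- the clockwise circle is `r * exp (i (π - t))`
  have h2 := eq_of_exp_eq_one
    (g := fun t : ℝ => L (0, t) - ((Real.log r : ℂ) + ((Real.pi - t : ℝ) : ℂ) * Complex.I))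
    (by fun_prop) (fun t => by
      rw [Complex.exp_sub, hexp, Complex.exp_add, ← Complex.ofReal_exp, Real.exp_log hr,
        Complex.exp_mul_I, ← Complex.ofReal_cos, ← Complex.ofReal_sin, Real.cos_pi_sub,
        Real.sin_pi_sub]
      have : G (0, t) = r * (((-Real.cos t : ℝ) : ℂ) + (Real.sin t : ℂ) * Complex.I) := by
        apply Complex.ext <;> simp [hG, hinit, -Complex.ofReal_cos, -Complex.ofReal_sin]
      rw [← this]
      refine div_self fun h => hF0 (0, t) ?_
      exact Prod.ext (congrArg Complex.re h) (congrArg Complex.im h)) (2 * Real.pi) 0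
  have h3 : L (1, 2 * Real.pi) - L (1, 0) = ((-(2 * Real.pi) : ℝ) : ℂ) * Complex.I := by
    rw [h1]
    push_cast at h2 ⊢
    linear_combination h2
  refine ⟨fun t => (L (1, t)).im, Continuous.continuousOn (by fun_prop), fun t _ => ?_, ?_⟩
  · refine ⟨Real.exp (L (1, t)).re, Real.exp_pos _, ?_⟩
    have hre := congrArg Complex.re (hexp (1, t))
    have him := congrArg Complex.im (hexp (1, t))
    rw [Complex.exp_re] at hre
    rw [Complex.exp_im] at him
    exact congrArg (q + ·) (Prod.ext hre.symm him.symm)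
  · have := congrArg Complex.im h3
    rw [Complex.sub_im, Complex.im_ofReal_mul, Complex.I_im] at this
    simp only [this]
    push_cast
    ring

lemma circlePath_ne (p : ℝ × ℝ) {r : ℝ} (hr : 0 < r) (t : ℝ) : circlePath p r t ≠ p := by
  intro h
  have h1 : r * Real.cos t = 0 := by simpa [circlePath] using congrArg Prod.fst h
  have h2 : r * Real.sin t = 0 := by simpa [circlePath] using congrArg Prod.snd h
  have h3 := (mul_eq_zero.1 h1).resolve_left hr.ne'
  have h4 := (mul_eq_zero.1 h2).resolve_left hr.ne'
  have := Real.sin_sq_add_cos_sq t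
  simp [h3, h4] at this

/-- Scaling `c` and the shift by `τ ∈ [0, 1]` deforms the map through injective maps to the
reflection in the vertical axis. -/
lemma planeGlide_hasWindingNumber {c : ℝ → ℝ} (hc : Continuous c) (hb : ∀ t, |c t| ≤ 1)
    (p : ℝ × ℝ) {r : ℝ} (hr : 0 < r) :
    HasWindingNumber (fun t => planeGlide c 1 (circlePath p r t)) (planeGlide c 1 p) (-1) := by
  have hcont := planeGlide_continuous (c := fun τ t => τ * c t) (s := id)
    (by fun_prop) (fun τ t => by
      rw [abs_mul]; exact mul_le_of_le_one_right (abs_nonneg _) (hb t)) continuous_id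
  have hinj : ∀ τ, Function.Injective (planeGlide (fun t => τ * c t) τ) := fun τ =>
    Function.LeftInverse.injective (g := planeGlide (fun t => τ * c (t - τ)) (-τ))
      (planeGlide_inverse (add_neg_cancel τ) fun t => by rw [add_sub_cancel_right])
  have hcirc : Continuous (circlePath p r) := by unfold circlePath; fun_prop
  have := hasWindingNumber_of_homotopy
    (F := fun x => planeGlide (fun t => x.1 * c t) x.1 (circlePath p r x.2) -
      planeGlide (fun t => x.1 * c t) x.1 p)
    ((hcont.comp (continuous_fst.prodMk (hcirc.comp continuous_snd))).sub
      (hcont.comp (continuous_fst.prodMk continuous_const)))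
    (fun x => sub_ne_zero.2 ((hinj x.1).ne (circlePath_ne p hr x.2)))
    (fun τ => by simp [circlePath]) hr
    (fun t => by
      simp only [zero_mul, planeGlide_zero]
      ext <;> simp [circlePath]) (planeGlide c 1 p)
  simpa only [one_mul, add_sub_cancel] using this

/-! ### Asymptotics of the orbits -/

lemma glide_iterate {c : ℝ → ℝ} {s t : ℝ} {b : ℕ → ℝ}
    (hb : ∀ n : ℕ, c (t + s * n) = (-1) ^ n * b n) (l : ℝ) (n : ℕ) :
    (glide c s)^[n] (l, t) = ((-1) ^ n * (l - ∑ k ∈ Finset.range n, b k), t + s * n) := by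
  induction n with
  | zero => simp
  | succ n ih =>
    rw [Function.iterate_succ_apply', ih, glide, Finset.sum_range_succ]
    refine Prod.ext ?_ ?_
    · simp only [hb, pow_succ]; ring
    · push_cast; ring

lemma planeGlide_iterate_chart (c : ℝ → ℝ) (s : ℝ) (p : ℝ × ℝ) (n : ℕ) :
    (planeGlide c s)^[n] (chart p) = chart ((glide c s)^[n] p) :=
  ((show Function.Semiconj chart (glide c s) (planeGlide c s) from
    fun q => (planeGlide_chart c s q).symm).iterate_right n p).symm

/-- Along a sequence with `|ℓ|` growing linearly and alternating in sign, and `t` growing at most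
linearly, `w = t / (1 + ℓ²)` tends to `0`, so that the points alternately approach `(1, 0)` and
`(-1, 0)`. -/
lemma tendsto_chart_sub {m : ℕ → ℝ} {K e : ℝ} (he : e = 1 ∨ e = -1)
    (hm : ∀ᶠ n : ℕ in atTop, m n = K + e * n) (s t : ℝ) :
    Tendsto (fun n : ℕ => chart ((-1) ^ n * m n, t + s * n) - (-1 : ℝ) ^ n • ((e, 0) : ℝ × ℝ))
      atTop (𝓝 0) := by
  have he2 : e ^ 2 = 1 := by rcases he with rfl | rfl <;> norm_num
  -- everything is a continuous function of `i = 1 / n`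
  let D : ℝ → ℝ := fun i => i ^ 2 + (K * i + e) ^ 2
  let W : ℝ → ℝ := fun i => (t * i + s) * i / D i
  let P : ℝ → ℝ := fun i => (K * i + e) / √(D i) * √(1 + W i ^ 2)
  let Q : ℝ → ℝ := fun i => i / √(D i) * W i
  have hD0 : D 0 = 1 := by simp [D, he2]
  have hD : ContinuousAt D 0 := by fun_prop
  have hW : ContinuousAt W 0 := ContinuousAt.div (by fun_prop) hD (by simp [hD0])
  have hsq : √(D 0) ≠ 0 := by simp [hD0]
  have hP : ContinuousAt P 0 := by fun_prop (disch := assumption)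
  have hQ : ContinuousAt Q 0 := by fun_prop (disch := assumption)
  have hP0 : P 0 = e := by simp [P, W, hD0]
  have hQ0 : Q 0 = 0 := by simp [Q]
  have hi : Tendsto (fun n : ℕ => (1 : ℝ) / n) atTop (𝓝 0) := tendsto_one_div_atTop_nhds_zero_nat
  have hPt : Tendsto (fun n : ℕ => P (1 / n) - e) atTop (𝓝 0) := by
    have h := (hP.tendsto.comp hi).sub_const e
    rwa [hP0, sub_self] at h
  have hQt : Tendsto (fun n : ℕ => Q (1 / n)) atTop (𝓝 0) := by
    have h := hQ.tendsto.comp hi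
    rwa [hQ0] at h
  refine squeeze_zero_norm' ?_ (by simpa only [norm_zero, max_self] using hPt.norm.max hQt.norm)
  filter_upwards [hm, eventually_gt_atTop 0] with n hn hn0
  have hn1 : (0 : ℝ) < n := Nat.cast_pos.2 hn0
  have hsgn : ((-1 : ℝ) ^ n) ^ 2 = 1 := by rw [← pow_mul, mul_comm, pow_mul]; norm_num
  have hDn : 1 + m n ^ 2 = D (1 / n) * (n : ℝ) ^ 2 := by
    simp only [hn, D]; field_simp
  have hDpos : 0 < D (1 / n) := by simp only [D]; positivity
  have hroot : √(1 + m n ^ 2) = √(D (1 / n)) * n := by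
    rw [hDn, Real.sqrt_mul hDpos.le, Real.sqrt_sq hn1.le]
  have hrpos : 0 < √(D (1 / n)) := Real.sqrt_pos.2 hDpos
  have hWn : (t + s * n) / (1 + m n ^ 2) = W (1 / n) := by
    rw [hDn]; simp only [W]; field_simp
  have hch : chart ((-1) ^ n * m n, t + s * n) = ((-1) ^ n * P (1 / n), Q (1 / n)) := by
    simp only [chart, fold, interiorPt, mul_pow, hsgn, one_mul, hWn, hroot]
    refine Prod.ext ?_ ?_
    · simp only [P, hn]; field_simp
    · simp only [Q]; field_simp
  rw [hch]
  simp only [Prod.smul_mk, Prod.mk_sub_mk, smul_eq_mul, mul_zero, sub_zero, ← mul_sub,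
    Prod.norm_def, norm_mul, norm_pow, norm_neg, norm_one, one_pow, one_mul, le_refl]

lemma planeGlide_tendsto {c : ℝ → ℝ} {s t : ℝ} {b : ℕ → ℝ}
    (hb : ∀ n : ℕ, c (t + s * n) = (-1) ^ n * b n) {e : ℝ} (he : e = 1 ∨ e = -1)
    (hbe : ∀ᶠ n in atTop, b n = -e) (l : ℝ) :
    Tendsto (fun n : ℕ => (planeGlide c s)^[n] (chart (l, t)) - (-1 : ℝ) ^ n • ((e, 0) : ℝ × ℝ))
      atTop (𝓝 0) := by
  simp only [planeGlide_iterate_chart, glide_iterate hb]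
  obtain ⟨N, hN⟩ := eventually_atTop.1 hbe
  refine tendsto_chart_sub (K := l - ∑ k ∈ Finset.range N, b k - e * N) he ?_ s t
  filter_upwards [eventually_ge_atTop N] with n hn
  induction n, hn using Nat.le_induction with
  | base => ring
  | succ n hn ih =>
    rw [Finset.sum_range_succ, hN n hn]
    push_cast
    linear_combination ih

section Alternating

variable {E : Type*} [NormedAddCommGroup E] [NormedSpace ℝ E]

lemma omegaLimitSet_of_alternating {f : E ≃ₜ E} {x v : E}
    (h : Tendsto (fun n : ℕ => f^[n] x - (-1 : ℝ) ^ n • v) atTop (𝓝 0)) :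
    omegaLimitSet f x = {v, -v} := by
  ext y
  constructor
  · rintro ⟨n, hn, -, hy⟩
    have h1 : Tendsto (fun i => (-1 : ℝ) ^ n i • v) atTop (𝓝 y) := by
      simpa using hy.sub (h.comp hn.tendsto_atTop)
    refine (Set.toFinite {v, -v}).isClosed.mem_of_tendsto h1 (Eventually.of_forall fun i => ?_)
    rcases neg_one_pow_eq_or ℝ (n i) with h2 | h2 <;> simp [h2]
  · rintro (rfl | rfl)
    · have hn : StrictMono fun i : ℕ => 2 * (i + 1) := fun i j hij => by dsimp only; omega
      refine ⟨_, hn, fun i => by omega, ?_⟩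
      simpa [pow_mul] using (h.comp hn.tendsto_atTop).add_const y
    · have hn : StrictMono fun i : ℕ => 2 * i + 1 := fun i j hij => by dsimp only; omega
      refine ⟨_, hn, fun i => by omega, ?_⟩
      simpa [pow_succ, pow_mul] using (h.comp hn.tendsto_atTop).add_const (-v)

lemma isBounded_iterates_of_alternating {f : E → E} {x v : E}
    (h : Tendsto (fun n : ℕ => f^[n] x - (-1 : ℝ) ^ n • v) atTop (𝓝 0)) :
    Bornology.IsBounded (Set.range fun n : ℕ => f^[n] x) := by
  obtain ⟨C, hC⟩ := (Metric.isBounded_range_of_tendsto _ h).exists_norm_le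
  refine isBounded_iff_forall_norm_le.2 ⟨C + ‖v‖, ?_⟩
  rintro _ ⟨n, rfl⟩
  have h1 := hC _ ⟨n, rfl⟩
  have h2 : ‖(-1 : ℝ) ^ n • v‖ = ‖v‖ := by simp [norm_smul]
  calc ‖f^[n] x‖ = ‖(f^[n] x - (-1 : ℝ) ^ n • v) + (-1 : ℝ) ^ n • v‖ := by rw [sub_add_cancel]
    _ ≤ C + ‖v‖ := (norm_add_le _ _).trans (by rw [h2]; gcongr)

end Alternating

lemma orbit_subset {X : Type*} [TopologicalSpace X] (f : X ≃ₜ X) (x : X) :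
    orbit f x ⊆ (Set.range fun n : ℕ => f^[n] x) ∪ Set.range fun n : ℕ => f.symm^[n] x := by
  have key : ∀ (g : X ≃ₜ X) (n : ℕ), (g ^ n) x = g^[n] x := by
    intro g n
    induction n with
    | zero => rfl
    | succ n ih =>
      rw [pow_succ', Function.iterate_succ_apply', ← ih]
      rfl
  rintro _ ⟨n, rfl⟩
  rcases n.eq_nat_or_neg with ⟨k, rfl | rfl⟩
  · exact Or.inl ⟨k, by simp only [zpow_natCast, key]⟩
  · refine Or.inr ⟨k, ?_⟩
    simp only [zpow_neg, zpow_natCast, ← inv_pow]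
    exact (key f.symm k).symm

/-! ### The drift -/

/-- The truncation of a real number to `[-1, 1]`. -/
def clamp (x : ℝ) : ℝ := max (-1) (min 1 x)

lemma clamp_abs_le (x : ℝ) : |clamp x| ≤ 1 :=
  abs_le.2 ⟨le_max_left _ _, max_le (by norm_num) (min_le_left _ _)⟩

lemma clamp_of_one_le {x : ℝ} (h : 1 ≤ x) : clamp x = 1 := by
  rw [clamp, min_eq_left h]; norm_num

lemma clamp_neg (x : ℝ) : clamp (-x) = -clamp x := by
  unfold clamp
  rcases le_total x 1 with h1 | h1 <;> rcases le_total x (-1) with h2 | h2 <;>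
    grind

lemma clamp_of_le_neg_one {x : ℝ} (h : x ≤ -1) : clamp x = -1 := by
  rw [← neg_neg x, clamp_neg, clamp_of_one_le (by linarith)]

/-- The horizontal drift. For fixed `t`, the sequence `(-1)ⁿ drift (t + n)` is eventually constant
with value `1` or `-1`, although `drift` is continuous and the constant changes sign when `t`
increases by `1`. Where `cos (π t)` vanishes, the summand `sin (π t) = ±1` provides the constant. -/
noncomputable def drift (t : ℝ) : ℝ := clamp (t * Real.cos (Real.pi * t) + Real.sin (Real.pi * t))

lemma drift_continuous : Continuous drift := by
  unfold drift clamp; fun_prop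

lemma drift_add_int (t : ℝ) (n : ℤ) :
    drift (t + n) =
      (-1) ^ n * clamp ((t + n) * Real.cos (Real.pi * t) + Real.sin (Real.pi * t)) := by
  rw [drift, show Real.pi * (t + n) = Real.pi * t + n * Real.pi by ring, Real.cos_add_int_mul_pi,
    Real.sin_add_int_mul_pi]
  rcases n.even_or_odd with h | h
  · simp [h.neg_one_zpow]
  · rw [h.neg_one_zpow, neg_one_mul, neg_one_mul, neg_one_mul, ← clamp_neg]
    congr 1
    ring

lemma eventually_clamp_eq (t x : ℝ) {s : ℝ} (hs : s ≠ 0) :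
    ∃ e : ℝ, (e = 1 ∨ e = -1) ∧ ∀ᶠ n : ℕ in atTop,
      clamp ((x + s * n) * Real.cos (Real.pi * t) + Real.sin (Real.pi * t)) = e := by
  set C := Real.cos (Real.pi * t)
  set S := Real.sin (Real.pi * t)
  have hlim : ∀ {d : ℝ}, 0 < d → ∀ y : ℝ, ∀ᶠ n : ℕ in atTop, 1 ≤ y + d * n := fun {d} hd y =>
    (tendsto_atTop_add_const_left _ y
      (tendsto_natCast_atTop_atTop.const_mul_atTop hd)).eventually_ge_atTop 1
  rcases lt_trichotomy (s * C) 0 with h | h | h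
  · refine ⟨-1, Or.inr rfl, ?_⟩
    filter_upwards [hlim (neg_pos.2 h) (-(x * C + S))] with n hn
    exact clamp_of_le_neg_one (by linarith)
  · have hC : C = 0 := (mul_eq_zero.1 h).resolve_left hs
    have hS : S ^ 2 = 1 := by
      have := Real.sin_sq_add_cos_sq (Real.pi * t)
      simpa [C, S, hC] using this
    simp only [hC, mul_zero, zero_add]
    rcases sq_eq_one_iff.1 hS with h1 | h1
    · exact ⟨1, Or.inl rfl, Eventually.of_forall fun _ => clamp_of_one_le h1.ge⟩
    · exact ⟨-1, Or.inr rfl, Eventually.of_forall fun _ => clamp_of_le_neg_one h1.le⟩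
  · refine ⟨1, Or.inl rfl, ?_⟩
    filter_upwards [hlim h (x * C + S)] with n hn
    exact clamp_of_one_le (by linarith)

/-! ### The homeomorphism -/

/-- The homeomorphism of the plane induced by `(ℓ, t) ↦ (-ℓ + drift t, t + 1)`. -/
noncomputable def driftHomeo : (ℝ × ℝ) ≃ₜ (ℝ × ℝ) where
  toFun := planeGlide drift 1
  invFun := planeGlide (fun t => drift (t - 1)) (-1)
  left_inv := planeGlide_inverse (by norm_num) fun t => by rw [add_sub_cancel_right]
  right_inv := planeGlide_inverse (by norm_num) fun t => by rw [← sub_eq_add_neg]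
  continuous_toFun := by
    have := planeGlide_continuous (c := fun τ t => τ * drift t) (s := id)
      (by have := drift_continuous; fun_prop) (fun τ t => by
        rw [abs_mul]; exact mul_le_of_le_one_right (abs_nonneg _) (clamp_abs_le _)) continuous_id
    simpa [Function.comp_def] using this.comp (continuous_const (y := (1 : ℝ)).prodMk continuous_id)
  continuous_invFun := by
    have := planeGlide_continuous (c := fun τ t => τ * drift (t - 1)) (s := fun τ => -τ)
      (by have := drift_continuous; fun_prop) (fun τ t => by
        rw [abs_mul]; exact mul_le_of_le_one_right (abs_nonneg _) (clamp_abs_le _)) continuous_neg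
    simpa [Function.comp_def] using this.comp (continuous_const (y := (1 : ℝ)).prodMk continuous_id)

lemma driftHomeo_tendsto (p : ℝ × ℝ) : ∃ e : ℝ, (e = 1 ∨ e = -1) ∧
    Tendsto (fun n : ℕ => driftHomeo^[n] (chart p) - (-1 : ℝ) ^ n • ((e, 0) : ℝ × ℝ))
      atTop (𝓝 0) := by
  obtain ⟨l, t⟩ := p
  obtain ⟨e, he, h⟩ := eventually_clamp_eq t t one_ne_zero
  refine ⟨-e, by rcases he with rfl | rfl <;> simp, ?_⟩
  refine planeGlide_tendsto (b := fun n : ℕ =>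
    clamp ((t + 1 * n) * Real.cos (Real.pi * t) + Real.sin (Real.pi * t))) (fun n => ?_)
    (by rcases he with rfl | rfl <;> simp) (by simpa using h) l
  simpa using drift_add_int t n

lemma driftHomeo_symm_tendsto (p : ℝ × ℝ) : ∃ e : ℝ, (e = 1 ∨ e = -1) ∧
    Tendsto (fun n : ℕ => driftHomeo.symm^[n] (chart p) - (-1 : ℝ) ^ n • ((e, 0) : ℝ × ℝ))
      atTop (𝓝 0) := by
  obtain ⟨l, t⟩ := p
  obtain ⟨e, he, h⟩ := eventually_clamp_eq t (t - 1) (neg_ne_zero.2 one_ne_zero)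
  refine ⟨e, he, ?_⟩
  refine planeGlide_tendsto (b := fun n : ℕ =>
    -clamp ((t - 1 + -1 * n) * Real.cos (Real.pi * t) + Real.sin (Real.pi * t))) (fun n => ?_)
    he (by filter_upwards [h] with n hn; rw [hn]) l
  have h1 := drift_add_int t (-(n + 1 : ℤ))
  have h2 : (-1 : ℝ) ^ (-(n + 1 : ℤ)) = -(-1) ^ n := by
    rw [zpow_neg, ← inv_zpow, inv_neg_one, zpow_add_one₀ (by norm_num), zpow_natCast]; ring
  rw [h2] at h1
  push_cast at h1
  rw [show t + -1 * (n : ℝ) - 1 = t + -(n + 1 : ℝ) by ring, h1,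
    show t - 1 + -1 * (n : ℝ) = t + -(n + 1 : ℝ) by ring]
  ring

lemma driftHomeo_ray {z : ℝ × ℝ} (h1 : z.1 ≤ -1 ∨ 1 ≤ z.1) (h2 : z.2 = 0) :
    driftHomeo z = (-z.1, 0) := planeGlide_ray _ _ h1 h2

lemma driftHomeo_chart (p : ℝ × ℝ) : driftHomeo (chart p) = chart (glide drift 1 p) :=
  planeGlide_chart _ _ p

lemma driftHomeo_ne (z : ℝ × ℝ) : driftHomeo z ≠ z := by
  intro h
  rcases ray_or_chart z with ⟨h1, h2⟩ | ⟨p, rfl⟩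
  · rw [driftHomeo_ray h1 h2] at h
    have := congrArg Prod.fst h
    simp only at this
    rcases h1 with h1 | h1 <;> linarith
  · rw [driftHomeo_chart] at h
    have := congrArg Prod.snd (chart_injective h)
    simp [glide] at this

lemma driftHomeo_isPeriodicPt_two {z : ℝ × ℝ} (h1 : z.1 ≤ -1 ∨ 1 ≤ z.1) (h2 : z.2 = 0) :
    Function.IsPeriodicPt driftHomeo 2 z := by
  change driftHomeo (driftHomeo z) = z
  rw [driftHomeo_ray h1 h2, driftHomeo_ray]
  · simp [← h2]
  · rcases h1 with h | h
    · right; simp only; linarith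
    · left; simp only; linarith
  · rfl

lemma driftHomeo_periodicPts :
    Function.periodicPts driftHomeo = {x : ℝ × ℝ | (x.1 ≤ -1 ∨ 1 ≤ x.1) ∧ x.2 = 0} := by
  ext z
  refine ⟨?_, fun h => ⟨2, two_pos, driftHomeo_isPeriodicPt_two h.1 h.2⟩⟩
  rintro ⟨n, hn, hz⟩
  refine (ray_or_chart z).resolve_right ?_
  rintro ⟨p, rfl⟩
  have h1 : chart ((glide drift 1)^[n] p) = chart p :=
    (planeGlide_iterate_chart drift 1 p n).symm.trans hz
  have h2 : ∀ k : ℕ, ((glide drift 1)^[k] p).2 = p.2 + k := by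
    intro k
    induction k with
    | zero => simp
    | succ k ih => rw [Function.iterate_succ_apply', glide, ih]; push_cast; ring
  have h3 := congrArg Prod.snd (chart_injective h1)
  rw [h2] at h3
  have : (n : ℝ) ≠ 0 := by positivity
  exact this (by linarith)

end PlaneHomeo

theorem theorem1p2 :
    ∃ h : (ℝ × ℝ) ≃ₜ (ℝ × ℝ),
      PlaneHomeo.IsOrientationReversing h ∧
      (∀ x, h x ≠ x) ∧
      Function.periodicPts h = {x : ℝ × ℝ | (x.1 ≤ -1 ∨ 1 ≤ x.1) ∧ x.2 = 0} ∧
      (∀ x ∈ Function.periodicPts h, Function.minimalPeriod h x = 2) ∧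
      (∀ x, x ∉ Function.periodicPts h →
        Bornology.IsBounded (PlaneHomeo.orbit h x) ∧
        PlaneHomeo.omegaLimitSet h x = {((-1 : ℝ), (0 : ℝ)), (1, 0)} ∧
        PlaneHomeo.alphaLimitSet h x = {((-1 : ℝ), (0 : ℝ)), (1, 0)}) ∧
      (∀ x, Bornology.IsBounded (PlaneHomeo.orbit h x)) := by
  open PlaneHomeo in
  have hset : ∀ e : ℝ, e = 1 ∨ e = -1 →
      ({((e, 0) : ℝ × ℝ), -(e, 0)} : Set (ℝ × ℝ)) = {((-1 : ℝ), (0 : ℝ)), (1, 0)} := by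
    rintro e (rfl | rfl)
    · rw [Set.pair_comm]; simp
    · simp
  have hnon : ∀ x, x ∉ Function.periodicPts driftHomeo →
      Bornology.IsBounded (orbit driftHomeo x) ∧
      omegaLimitSet driftHomeo x = {((-1 : ℝ), (0 : ℝ)), (1, 0)} ∧
      alphaLimitSet driftHomeo x = {((-1 : ℝ), (0 : ℝ)), (1, 0)} := by
    intro x hx
    rw [driftHomeo_periodicPts] at hx
    obtain ⟨p, rfl⟩ := (ray_or_chart x).resolve_left hx
    obtain ⟨e, he, h⟩ := driftHomeo_tendsto p
    obtain ⟨e', he', h'⟩ := driftHomeo_symm_tendsto p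
    exact ⟨((isBounded_iterates_of_alternating h).union
      (isBounded_iterates_of_alternating h')).subset (orbit_subset _ _),
      (omegaLimitSet_of_alternating h).trans (hset e he),
      (omegaLimitSet_of_alternating h').trans (hset e' he')⟩
  refine ⟨driftHomeo, fun p r hr =>
    planeGlide_hasWindingNumber drift_continuous (fun t => clamp_abs_le _) p hr, driftHomeo_ne,
    driftHomeo_periodicPts, fun x hx => ?_, hnon, fun x => ?_⟩
  · rw [driftHomeo_periodicPts] at hx
    exact Function.minimalPeriod_eq_prime (driftHomeo_isPeriodicPt_two hx.1 hx.2)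
      (driftHomeo_ne x)
  · by_cases hx : x ∈ Function.periodicPts driftHomeo
    · -- the orbit of a periodic point is `{x, h x}`
      have h2 : ∀ z, z ∈ Function.periodicPts driftHomeo →
          driftHomeo (driftHomeo z) = z := fun z hz => by
        rw [driftHomeo_periodicPts] at hz
        exact driftHomeo_isPeriodicPt_two hz.1 hz.2
      have hxx := h2 x hx
      refine (Set.toFinite {x, driftHomeo x}).isBounded.subset ((orbit_subset _ _).trans ?_)
      have hmaps : ∀ g : ℝ × ℝ → ℝ × ℝ, g x = driftHomeo x → g (driftHomeo x) = x →
          ∀ n : ℕ, g^[n] x ∈ ({x, driftHomeo x} : Set (ℝ × ℝ)) := by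
        intro g h1 h2 n
        induction n with
        | zero => simp
        | succ n ih =>
          rw [Function.iterate_succ_apply']
          rcases ih with h | h <;> rw [h] <;> simp [h1, h2]
      rintro _ (⟨n, rfl⟩ | ⟨n, rfl⟩)
      · exact hmaps _ rfl hxx n
      · exact hmaps _ (by rw [Homeomorph.symm_apply_eq, hxx]) (Homeomorph.symm_apply_apply _ _) n
    · exact (hnon x hx).1
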